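/- **KuLSIF convergence in infinity norm.** Let $(X,Z)$ have joint law $P$ on $\mathcal X\times\mathcal Z$, let $P_Z$ be the marginal law of $Z$, and let $\Pi$ be another probability measure (the prior) on $\mathcal Z$. Suppose $P_Z$ and $\Pi$ have densities $p$ and $\pi$ with respect to a common measure on the topological space $\mathcal Z$ (with a $\sigma$-algebra containing the Borel sets). Let $\mathcal H$ be a separable real reproducing kernel Hilbert space on $\mathcal Z$ with continuous kernel $k$ and feature map $\phi(z)=k(z,\cdot)$, with $\|\phi(z)\|\le\kappa_1<\infty$ for $P_Z$-almost every $z$. Put $m_\Pi=E_{Z\sim \Pi}[\phi(Z)]$ and $C=C^{(P)}_{ZZ}=E_{P}[\phi(Z)\otimes\phi(Z)]$, where $(a\otimes b)c=\langle b,c\rangle a$. Powers of the compact positive operator $C$ are taken through its eigendecomposition. Assume that the density ratio $r_0=\pi/p$ lies in $\mathcal H$, i.e. $r_0\in\mathcal H$, $r_0\ge 0$ everywhere, and $\pi=r_0\,p$ almost everywhere with respect to the common measure, and that $r_0=C^{\beta_1}g_1$ for some $g_1\in\mathcal H$ with $\|g_1\|\le\zeta_1<\infty$ and some $\beta_1\in(0,1/2]$.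 Let $(x_i,z_i)_{i\ge1}$ be i.i.d. with law $P$, let $\hat C_n=\frac1n\sum_{i=1}^n\phi(z_i)\otimes\phi(z_i)$, and let $\hat m_n$ be $\mathcal H$-valued estimators (which may depend on the data) with $\|\hat m_n-m_\Pi\|=O_p(n^{-\alpha_1})$ for some $\alpha_1\in(0,1/2]$. Let $\eta_n$ be deterministic, positive for all large $n$, with $\eta_n\asymp n^{-\alpha_1/(\beta_1+1)}$, and let $$\hat r_n(z)=\max\bigl(0,\;[(\hat C_n+\eta_n I)^{-1}\hat m_n](z)\bigr).$$ Then $$\|r_0-\hat r_n\|_{L^\infty(P_Z)}=O_p\!\left(n^{-\frac{\alpha_1\beta_1}{\beta_1+1}}\right),$$ and if moreover $\|\phi(z)\|\le\kappa_1$ holds for every $z\in\mathcal Z$, then $$\sup_{z\in\mathcal Z}|r_0(z)-\hat r_n(z)|=O_p\!\left(n^{-\frac{\alpha_1\beta_1}{\beta_1+1}}\right).$$ Here $X_n=O_p(a_n)$ means: for every $\varepsilon>0$ there is $M$ with $\Pr(X_n>Ma_n)\le\varepsilon$ for all large $n$. -/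

import Mathlib

open MeasureTheory ProbabilityTheory Filter Topology
open scoped ENNReal

namespace KuLSIF

noncomputable section

section RKHSObjects

variable {𝒵 : Type*} (H : Type*) [NormedAddCommGroup H] [InnerProductSpace ℝ H] [CompleteSpace H]
  [RKHS ℝ H 𝒵 ℝ]

/-- The canonical feature map `φ(z) = k(z, ·)` of a scalar-valued RKHS. -/
def featureMap (z : 𝒵) : H := RKHS.kerFun H z (1 : ℝ)

/-- The scalar reproducing kernel `k(z, z')` of a scalar-valued RKHS. -/
def scalarKernel (z z' : 𝒵) : ℝ := RKHS.kernel H z z' (1 : ℝ)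

/-- The kernel mean embedding `m_Q = E_Q[φ(Z)]` (Bochner integral in `H`). -/
def meanEmbedding [MeasurableSpace 𝒵] (Q : Measure 𝒵) : H := ∫ z, featureMap H z ∂Q

/-- The (uncentred) covariance operator `E_Q[φ(Z) ⊗ φ(Z)]`, where `(a ⊗ b) c = ⟨b, c⟩ a`
(Bochner integral in the space of bounded operators on `H`). -/
def covOp [MeasurableSpace 𝒵] (Q : Measure 𝒵) : H →L[ℝ] H :=
  ∫ z, InnerProductSpace.rankOne ℝ (featureMap H z) (featureMap H z) ∂Q

/-- The empirical covariance operator `(1/n) ∑_{i < n} φ(z_i) ⊗ φ(z_i)` of the first `n` points of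
a sequence. -/
def empCovOp (z : ℕ → 𝒵) (n : ℕ) : H →L[ℝ] H :=
  (n : ℝ)⁻¹ • ∑ i ∈ Finset.range n,
    InnerProductSpace.rankOne ℝ (featureMap H (z i)) (featureMap H (z i))

variable {H}

/-- The untruncated estimator `(Ĉ + η I)⁻¹ m̂`, where `Ĉ` is the empirical covariance operator of
`z_0, …, z_{n-1}`. -/
def kulsifUntruncated (z : ℕ → 𝒵) (n : ℕ) (η : ℝ) (m : H) : H :=
  (empCovOp H z n + η • ContinuousLinearMap.id ℝ H).inverse m

/-- The truncated KuLSIF estimator `r̂(x) = max(0, ((Ĉ + η I)⁻¹ m̂)(x))`. -/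
def kulsif (z : ℕ → 𝒵) (n : ℕ) (η : ℝ) (m : H) (x : 𝒵) : ℝ :=
  max 0 (kulsifUntruncated z n η m x)

end RKHSObjects

/-- The fractional power `C^β g = ∑_ν ν^β P_ν g` (`β > 0`) of a compact positive self-adjoint
operator `C`, where `P_ν` is the orthogonal projection onto the eigenspace `ker (C - ν I)`. The sum
may run over all real `ν`, since `P_ν = 0` unless `ν` is an eigenvalue. -/
def fracPow {H : Type*} [NormedAddCommGroup H] [InnerProductSpace ℝ H] [CompleteSpace H]
    (C : H →L[ℝ] H) (β : ℝ) (g : H) : H :=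
  ∑' ν : ℝ, (ν ^ β) •
    (C - ν • ContinuousLinearMap.id ℝ H).ker.starProjection g

/-- `r` is (a version of) the density ratio `π / p` of two densities with respect to the base
measure `ν`: it is nonnegative and `π = r p` holds `ν`-almost everywhere. So `r = π / p` almost
everywhere on `{p > 0}`, the measure with density `π` is absolutely continuous with respect to the
one with density `p`, and on `{p = 0}`, where the quotient is undefined, `r` may have any
nonnegative value. -/
structure IsDensityRatio {𝒵 : Type*} [MeasurableSpace 𝒵] (ν : Measure 𝒵) (p π r : 𝒵 → ℝ) :
    Prop where
  nonneg : ∀ z, 0 ≤ r z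
  eq_mul : ∀ᵐ z ∂ν, π z = r z * p z

/-- The supremum norm `‖f‖_∞ = sup_z |f z|`, with values in `[0, ∞]`. -/
def supNorm {𝒵 : Type*} (f : 𝒵 → ℝ) : ℝ≥0∞ := ⨆ z, ‖f z‖ₑ

/-- `X_n = O_p(a_n)`: for every `ε > 0` there is `M` such that `Pr(X_n > M a_n) ≤ ε` for all large
`n`. (The probability is an outer probability if the event is not measurable.) -/
def IsBigOp {Ω : Type*} [MeasurableSpace Ω] (Pr : Measure Ω) (X : ℕ → Ω → ℝ≥0∞) (a : ℕ → ℝ) :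
    Prop :=
  ∀ ε : ℝ≥0∞, 0 < ε → ∃ M : ℝ, 0 < M ∧
    ∀ᶠ n in atTop, Pr {ω | ENNReal.ofReal (M * a n) < X n ω} ≤ ε

end

end KuLSIF

namespace KuLSIF

/-! ### Tikhonov regularization for positive operators -/

section Operators

variable {H : Type*} [NormedAddCommGroup H] [InnerProductSpace ℝ H]

/-! Since `π = r₀ p`, the prior embedding is `C r₀`, so the estimator is Tikhonov regularization of
`C r = m_Π` with noisy operator and noisy right side. Compare it with the noiseless regularized
solution `v = (C + η)⁻¹ C r₀ = r₀ - η (C + η)⁻¹ r₀`. As `(C + η) v = C r₀`, the estimate `f`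
satisfies `(Ĉ + η)(f - v) = (m̂ - C r₀) - (Ĉ - C) v`, and coercivity of `Ĉ + η` costs a factor `η⁻¹`
(`norm_inverse_apply_sub_le`).

The operator noise thus acts only on the deterministic vector `v`, of norm at most `2 ‖r₀‖`, so
Chebyshev's inequality for a sum of `H`-valued variables suffices and no operator-norm concentration
is needed. The bias `η (C + η)⁻¹ C^β g` has norm at most `η^β ‖g‖` (`norm_smul_inverse_fracPow_le`).

The total is `O_p(η⁻¹ n^(-α) + η^β)`; the two terms balance at `η ≍ n^(-α/(β+1))`. The reproducing
property turns this `H`-norm rate into a uniform one, and truncation at zero does no harm because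
`r₀ ≥ 0`. -/

theorem le_norm_add_smul_id (T : H →L[ℝ] H) (hT : ∀ x, 0 ≤ inner ℝ (T x) x) {η : ℝ}
    (x : H) : η * ‖x‖ ≤ ‖(T + η • ContinuousLinearMap.id ℝ H) x‖ := by
  rcases eq_or_ne x 0 with rfl | hx
  · simp
  have hx' : 0 < ‖x‖ := norm_pos_iff.mpr hx
  have h1 : inner ℝ ((T + η • ContinuousLinearMap.id ℝ H) x) x
      = inner ℝ (T x) x + η * ‖x‖ ^ 2 := by
    simp [inner_add_left, inner_smul_left]
  have h2 := real_inner_le_norm ((T + η • ContinuousLinearMap.id ℝ H) x) x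
  have h3 := hT x
  refine le_of_mul_le_mul_right ?_ hx'
  nlinarith

/-- Coercivity gives invertibility. This is what keeps `ContinuousLinearMap.inverse` away from its
default value `0`. -/
theorem isInvertible_add_smul_id [CompleteSpace H] (T : H →L[ℝ] H)
    (hT : ∀ x, 0 ≤ inner ℝ (T x) x) {η : ℝ} (hη : 0 < η) :
    (T + η • ContinuousLinearMap.id ℝ H).IsInvertible := by
  have hu : IsUnit (T + η • ContinuousLinearMap.id ℝ H) := by
    refine ContinuousLinearMap.isUnit_of_forall_le_norm_inner_map _ (c := ⟨η, hη.le⟩) hη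
      fun x => ?_
    have h1 : inner ℝ ((T + η • ContinuousLinearMap.id ℝ H) x) x
        = inner ℝ (T x) x + ‖x‖ ^ 2 * η := by
      simp [inner_add_left, inner_smul_left, mul_comm]
    rw [h1]
    exact (le_add_of_nonneg_left (hT x)).trans (le_abs_self _)
  obtain ⟨U, hU⟩ := hu
  exact ⟨ContinuousLinearEquiv.ofUnit U, by ext x; rw [← hU]; rfl⟩

/-- The projections of a vector onto finitely many eigenspaces of a symmetric operator, with
coefficients bounded by `M`, sum to a vector of norm at most `M` times that of the vector. -/
theorem norm_sum_smul_eigenprojection_le [CompleteSpace H] (C : H →L[ℝ] H)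
    (hC : (C : H →ₗ[ℝ] H).IsSymmetric) (g : H) (c : ℝ → ℝ) (M : ℝ) (hM : 0 ≤ M)
    (hc : ∀ ν, |c ν| * ‖(C - ν • ContinuousLinearMap.id ℝ H).ker.starProjection g‖
      ≤ M * ‖(C - ν • ContinuousLinearMap.id ℝ H).ker.starProjection g‖) (s : Finset ℝ) :
    ‖∑ ν ∈ s, c ν • (C - ν • ContinuousLinearMap.id ℝ H).ker.starProjection g‖ ≤ M * ‖g‖ := by
  set Q : ℝ → H := fun ν => (C - ν • ContinuousLinearMap.id ℝ H).ker.starProjection g with hQ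
  have hmem : ∀ ν, C (Q ν) = ν • Q ν := by
    intro ν
    have h : Q ν ∈ (C - ν • ContinuousLinearMap.id ℝ H).ker :=
      Submodule.starProjection_apply_mem _ _
    rw [LinearMap.mem_ker] at h
    simpa [sub_eq_zero] using h
  have horth : ∀ ν μ, ν ≠ μ → inner ℝ (Q ν) (Q μ) = 0 := by
    intro ν μ hne
    have h : inner ℝ (C (Q ν)) (Q μ) = inner ℝ (Q ν) (C (Q μ)) := hC _ _
    rw [hmem, hmem, real_inner_smul_left, real_inner_smul_right] at h
    have h' : (ν - μ) * inner ℝ (Q ν) (Q μ) = 0 := by linarith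
    exact (mul_eq_zero.mp h').resolve_left (sub_ne_zero.mpr hne)
  -- Pythagoras with free coefficients: used below for `1`, for `c` and for the constant `M`.
  have hpyth : ∀ d : ℝ → ℝ, ‖∑ ν ∈ s, d ν • Q ν‖ ^ 2 = ∑ ν ∈ s, (|d ν| * ‖Q ν‖) ^ 2 := by
    intro d
    rw [← real_inner_self_eq_norm_sq, sum_inner]
    refine Finset.sum_congr rfl fun ν hν => ?_
    rw [inner_sum, Finset.sum_eq_single ν]
    · rw [real_inner_self_eq_norm_sq, norm_smul, Real.norm_eq_abs]
    · intro μ _ hne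
      rw [real_inner_smul_left, real_inner_smul_right, horth ν μ hne.symm]
      simp
    · exact fun h => absurd hν h
  -- Bessel: the sum `S` satisfies `‖S‖² = ⟨S, g⟩ ≤ ‖S‖ ‖g‖`.
  have hbessel : ‖∑ ν ∈ s, Q ν‖ ≤ ‖g‖ := by
    have h1 : ‖∑ ν ∈ s, Q ν‖ ^ 2 = ∑ ν ∈ s, ‖Q ν‖ ^ 2 := by simpa using hpyth fun _ => 1
    have h2 : ∑ ν ∈ s, ‖Q ν‖ ^ 2 = inner ℝ (∑ ν ∈ s, Q ν) g := by
      rw [sum_inner]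
      refine Finset.sum_congr rfl fun ν _ => ?_
      exact ((C - ν • ContinuousLinearMap.id ℝ H).ker.re_inner_starProjection_eq_normSq g).symm
    have h3 := real_inner_le_norm (∑ ν ∈ s, Q ν) g
    rcases (norm_nonneg (∑ ν ∈ s, Q ν)).eq_or_lt with h0 | h0
    · rw [← h0]; exact norm_nonneg g
    · refine le_of_mul_le_mul_left ?_ h0
      nlinarith
  refine le_of_sq_le_sq ?_ (by positivity)
  calc ‖∑ ν ∈ s, c ν • Q ν‖ ^ 2 = ∑ ν ∈ s, (|c ν| * ‖Q ν‖) ^ 2 := hpyth c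
    _ ≤ ∑ ν ∈ s, (M * ‖Q ν‖) ^ 2 := by
        refine Finset.sum_le_sum fun ν _ => ?_
        exact pow_le_pow_left₀ (by positivity) (hc ν) 2
    _ = ‖∑ ν ∈ s, M • Q ν‖ ^ 2 := by rw [hpyth fun _ => M, abs_of_nonneg hM]
    _ = (M * ‖∑ ν ∈ s, Q ν‖) ^ 2 := by
        rw [← Finset.smul_sum, norm_smul, Real.norm_of_nonneg hM]
    _ ≤ (M * ‖g‖) ^ 2 := by gcongr

/-- Weighted AM-GM gives `ν^β η^(1-β) ≤ β ν + (1-β) η ≤ ν + η`. The left side is the multiplier by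
which `η (C + η)⁻¹ C^β` acts on the `ν`-eigenspace. -/
theorem mul_rpow_div_add_le {ν η β : ℝ} (hν : 0 ≤ ν) (hη : 0 < η) (hβ : 0 < β) (hβ' : β ≤ 1) :
    η * (ν ^ β / (ν + η)) ≤ η ^ β := by
  have h1 := Real.geom_mean_le_arith_mean2_weighted hβ.le (sub_nonneg.mpr hβ') hν hη.le
    (by ring)
  have h2 : ν ^ β * η ^ (1 - β) ≤ ν + η := by nlinarith
  have h3 : η = η ^ β * η ^ (1 - β) := by
    rw [← Real.rpow_add hη]; simp
  rw [← mul_div_assoc, div_le_iff₀ (by positivity)]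
  calc η * ν ^ β = η ^ β * (ν ^ β * η ^ (1 - β)) := by nth_rewrite 1 [h3]; ring
    _ ≤ η ^ β * (ν + η) := by gcongr

/-- The bias of Tikhonov regularization under a source condition. -/
theorem norm_smul_inverse_fracPow_le [CompleteSpace H] (C : H →L[ℝ] H)
    (hC : (C : H →ₗ[ℝ] H).IsSymmetric) (hpos : ∀ x, 0 ≤ inner ℝ (C x) x) {η β : ℝ}
    (hη : 0 < η) (hβ : 0 < β) (hβ' : β ≤ 1) (g : H) :
    ‖η • (C + η • ContinuousLinearMap.id ℝ H).inverse (fracPow C β g)‖ ≤ η ^ β * ‖g‖ := by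
  have hinv := isInvertible_add_smul_id C hpos hη
  set B := C + η • ContinuousLinearMap.id ℝ H with hB
  set Q : ℝ → H := fun ν => (C - ν • ContinuousLinearMap.id ℝ H).ker.starProjection g with hQ
  have hmem : ∀ ν, C (Q ν) = ν • Q ν := by
    intro ν
    have h : Q ν ∈ (C - ν • ContinuousLinearMap.id ℝ H).ker :=
      Submodule.starProjection_apply_mem _ _
    rw [LinearMap.mem_ker] at h
    simpa [sub_eq_zero] using h
  -- Negative indices must be discarded: there `ν ^ β` has no spectral meaning and `ν + η` may
  -- vanish.
  have hneg : ∀ ν < 0, Q ν = 0 := by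
    intro ν hν
    have h := hpos (Q ν)
    rw [hmem, real_inner_smul_left, real_inner_self_eq_norm_sq] at h
    have h' : ‖Q ν‖ ^ 2 ≤ 0 := by nlinarith [sq_nonneg ‖Q ν‖]
    simpa using le_antisymm h' (sq_nonneg _)
  have hBQ : ∀ ν, B.inverse (ν ^ β • Q ν) = (ν ^ β / (ν + η)) • Q ν := by
    intro ν
    rcases lt_or_ge ν 0 with hν | hν
    · simp [hneg ν hν]
    · rw [hinv.inverse_apply_eq, map_smul, hB]
      simp only [add_apply, smul_apply, ContinuousLinearMap.id_apply, hmem]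
      rw [← add_smul, smul_smul, div_mul_cancel₀ _ (by positivity)]
  -- If the family were not summable, `fracPow` would be the default `0` and the bound trivial; so
  -- no spectral theorem is needed.
  by_cases hs : Summable fun ν : ℝ => ν ^ β • Q ν
  · have hsum : HasSum (fun ν : ℝ => η • (ν ^ β / (ν + η)) • Q ν)
        (η • B.inverse (fracPow C β g)) := by
      have h := (B.inverse.hasSum hs.hasSum).const_smul η
      simp only [hBQ] at h
      exact h
    refine le_of_tendsto hsum.norm (Eventually.of_forall fun s => ?_)
    have := norm_sum_smul_eigenprojection_le C hC g (fun ν => η * (ν ^ β / (ν + η))) (η ^ β)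
      (by positivity) (fun ν => ?_) s
    · simpa only [mul_smul] using this
    · rcases lt_or_ge ν 0 with hν | hν
      · have h0 := hneg ν hν
        simp only [hQ] at h0
        rw [h0]
        simp
      · rw [abs_of_nonneg (by positivity)]
        gcongr
        exact mul_rpow_div_add_le hν hη hβ hβ'
  · have h0 : fracPow C β g = 0 := tsum_eq_zero_of_not_summable hs
    rw [h0]
    simp only [map_zero, smul_zero, norm_zero]
    positivity

/-- Error of the regularized solution of an operator equation `C r = b` with perturbed data
`T`, `m`: the perturbation of the operator enters only through its action on the regularized
solution `r - η (C + η)⁻¹ r` of the unperturbed equation. -/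
theorem norm_inverse_apply_sub_le [CompleteSpace H] (C T : H →L[ℝ] H)
    (hC : ∀ x, 0 ≤ inner ℝ (C x) x) (hT : ∀ x, 0 ≤ inner ℝ (T x) x) {η : ℝ} (hη : 0 < η)
    (r m : H) :
    ‖r - (T + η • ContinuousLinearMap.id ℝ H).inverse m‖ ≤
      η⁻¹ * ‖m - C r‖ +
      η⁻¹ * ‖(T - C) (r - η • (C + η • ContinuousLinearMap.id ℝ H).inverse r)‖ +
      ‖η • (C + η • ContinuousLinearMap.id ℝ H).inverse r‖ := by
  have hA := isInvertible_add_smul_id T hT hη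
  have hB := isInvertible_add_smul_id C hC hη
  have hlow := le_norm_add_smul_id T hT (η := η)
  obtain ⟨f, hf⟩ : ∃ f, (T + η • ContinuousLinearMap.id ℝ H).inverse m = f := ⟨_, rfl⟩
  obtain ⟨u, hu⟩ : ∃ u, (C + η • ContinuousLinearMap.id ℝ H).inverse r = u := ⟨_, rfl⟩
  have hf' := hA.inverse_apply_eq.mp hf
  have hu' := hB.inverse_apply_eq.mp hu
  rw [hf, hu]
  have hv : r - η • u = C u := by rw [hu']; simp
  have key : (T + η • ContinuousLinearMap.id ℝ H) (f - (r - η • u))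
      = (m - C r) - (T - C) (r - η • u) := by
    rw [map_sub, ← hf']
    -- With `v = r - η u = C u`, one has `η v = C (η u)`, hence `(C + η) v = C r`.
    have h2 : C r = C (r - η • u) + η • (r - η • u) := by
      conv_rhs => rw [map_sub, map_smul, hv]
      abel
    rw [h2]
    simp only [add_apply, sub_apply, smul_apply, ContinuousLinearMap.id_apply]
    abel
  have h1 : ‖f - (r - η • u)‖ ≤ η⁻¹ * (‖m - C r‖ + ‖(T - C) (r - η • u)‖) := by
    rw [le_inv_mul_iff₀ hη]
    refine (hlow _).trans ?_
    rw [key]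
    exact norm_sub_le _ _
  calc ‖r - f‖ = ‖η • u - (f - (r - η • u))‖ := by congr 1; abel
    _ ≤ ‖η • u‖ + ‖f - (r - η • u)‖ := norm_sub_le _ _
    _ ≤ _ := by linarith

end Operators

/-! ### Reproducing property and covariance operators -/

section FeatureMap

variable {𝒵 : Type*} {H : Type*} [NormedAddCommGroup H] [InnerProductSpace ℝ H] [CompleteSpace H]
  [RKHS ℝ H 𝒵 ℝ]

theorem inner_featureMap (z : 𝒵) (f : H) : inner ℝ (featureMap H z) f = f z := by
  simp [featureMap]

theorem abs_apply_le (f : H) (z : 𝒵) : |f z| ≤ ‖featureMap H z‖ * ‖f‖ := by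
  rw [← inner_featureMap]
  exact abs_real_inner_le_norm _ _

theorem scalarKernel_eq_inner (z z' : 𝒵) :
    scalarKernel H z z' = inner ℝ (featureMap H z) (featureMap H z') := by
  rw [inner_featureMap, featureMap, RKHS.kerFun_apply, scalarKernel]

/-- The squared feature distance is `k(z,z) - 2 k(z,z₀) + k(z₀,z₀)`, which is continuous in `z` and
vanishes at `z₀`. -/
theorem continuous_featureMap [TopologicalSpace 𝒵]
    (hk : Continuous fun q : 𝒵 × 𝒵 => scalarKernel H q.1 q.2) :
    Continuous (featureMap H : 𝒵 → H) := by
  rw [continuous_iff_continuousAt]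
  intro z₀
  rw [ContinuousAt, tendsto_iff_norm_sub_tendsto_zero]
  have h1 : ∀ z : 𝒵, ‖featureMap H z - featureMap H z₀‖ = √(scalarKernel H z z
      - 2 * scalarKernel H z z₀ + scalarKernel H z₀ z₀) := by
    intro z
    rw [scalarKernel_eq_inner, scalarKernel_eq_inner, scalarKernel_eq_inner,
      real_inner_self_eq_norm_sq, real_inner_self_eq_norm_sq, ← norm_sub_sq_real,
      Real.sqrt_sq (norm_nonneg _)]
  simp_rw [h1]
  have ha : Continuous fun z : 𝒵 => scalarKernel H z z :=
    hk.comp (g := fun q : 𝒵 × 𝒵 => scalarKernel H q.1 q.2) (f := fun z => (z, z)) (by fun_prop)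
  have hb : Continuous fun z : 𝒵 => scalarKernel H z z₀ :=
    hk.comp (g := fun q : 𝒵 × 𝒵 => scalarKernel H q.1 q.2) (f := fun z => (z, z₀)) (by fun_prop)
  have h2 : Continuous fun z : 𝒵 => √(scalarKernel H z z
      - 2 * scalarKernel H z z₀ + scalarKernel H z₀ z₀) :=
    ((ha.sub (hb.const_mul 2)).add_const (scalarKernel H z₀ z₀)).sqrt
  have h3 := h2.tendsto z₀
  have h4 : scalarKernel H z₀ z₀ - 2 * scalarKernel H z₀ z₀ + scalarKernel H z₀ z₀ = 0 := by ring
  rwa [h4, Real.sqrt_zero] at h3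

theorem inner_empCovOp_nonneg (z : ℕ → 𝒵) (n : ℕ) (x : H) :
    0 ≤ inner ℝ (empCovOp H z n x) x := by
  simp only [empCovOp, smul_apply, sum_apply, InnerProductSpace.rankOne_apply,
    real_inner_smul_left, sum_inner]
  exact mul_nonneg (by positivity) (Finset.sum_nonneg fun i _ => mul_self_nonneg _)

theorem empCovOp_apply (z : ℕ → 𝒵) (n : ℕ) (x : H) :
    empCovOp H z n x = (n : ℝ)⁻¹ • ∑ i ∈ Finset.range n, x (z i) • featureMap H (z i) := by
  simp [empCovOp, inner_featureMap]

/-- Truncation `t ↦ max 0 t` is 1-Lipschitz and fixes the values of `r`. -/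
theorem abs_sub_kulsif_le (r : H) (hr : ∀ z, 0 ≤ r z) (x : ℕ → 𝒵) (n : ℕ) (η : ℝ) (m : H)
    (z : 𝒵) :
    |r z - kulsif x n η m z| ≤ ‖featureMap H z‖ * ‖r - kulsifUntruncated x n η m‖ := by
  refine le_trans ?_ (abs_apply_le _ z)
  rw [RKHS.coe_sub, Pi.sub_apply, kulsif]
  conv_lhs => rw [← max_eq_right (hr z)]
  simpa using abs_max_sub_max_le_max 0 (r z) 0 (kulsifUntruncated x n η m z)

variable [MeasurableSpace 𝒵]

theorem integrable_rankOne_featureMap {Q : Measure 𝒵} [IsFiniteMeasure Q] {κ : ℝ}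
    (hφ : AEStronglyMeasurable (featureMap H : 𝒵 → H) Q)
    (hκ : ∀ᵐ z ∂Q, ‖featureMap H z‖ ≤ κ) :
    Integrable (fun z => InnerProductSpace.rankOne ℝ (featureMap H z) (featureMap H z)) Q := by
  refine Integrable.of_bound (C := κ * κ) ?_ ?_
  · have hc : Continuous fun x : H => InnerProductSpace.rankOne ℝ x x :=
      (InnerProductSpace.rankOne ℝ (E := H) (F := H)).continuous₂.comp (continuous_id.prodMk continuous_id)
    exact hc.comp_aestronglyMeasurable hφ
  · filter_upwards [hκ] with z hz
    rw [InnerProductSpace.norm_rankOne]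
    exact mul_le_mul hz hz (norm_nonneg _) ((norm_nonneg _).trans hz)

/-- Evaluation at `x` commutes with the operator-valued integral, so later arguments can work with
integrals in `H`. -/
theorem covOp_apply {Q : Measure 𝒵} [IsFiniteMeasure Q] {κ : ℝ}
    (hφ : AEStronglyMeasurable (featureMap H : 𝒵 → H) Q)
    (hκ : ∀ᵐ z ∂Q, ‖featureMap H z‖ ≤ κ) (x : H) :
    covOp H Q x = ∫ z, x z • featureMap H z ∂Q := by
  rw [covOp, ContinuousLinearMap.integral_apply (integrable_rankOne_featureMap hφ hκ)]
  simp_rw [InnerProductSpace.rankOne_apply, inner_featureMap]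

theorem integrable_apply_smul_featureMap {Q : Measure 𝒵} [IsFiniteMeasure Q] {κ : ℝ}
    (hφ : AEStronglyMeasurable (featureMap H : 𝒵 → H) Q)
    (hκ : ∀ᵐ z ∂Q, ‖featureMap H z‖ ≤ κ) (x : H) :
    Integrable (fun z => x z • featureMap H z) Q := by
  have h := (integrable_rankOne_featureMap hφ hκ).apply_continuousLinearMap x
  simpa only [InnerProductSpace.rankOne_apply, inner_featureMap] using h

theorem inner_covOp {Q : Measure 𝒵} [IsFiniteMeasure Q] {κ : ℝ}
    (hφ : AEStronglyMeasurable (featureMap H : 𝒵 → H) Q)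
    (hκ : ∀ᵐ z ∂Q, ‖featureMap H z‖ ≤ κ) (x y : H) :
    inner ℝ (covOp H Q x) y = ∫ z, x z * y z ∂Q := by
  rw [covOp_apply hφ hκ, real_inner_comm,
    ← integral_inner (integrable_apply_smul_featureMap hφ hκ x)]
  simp_rw [real_inner_smul_right, real_inner_comm _ y, inner_featureMap]

theorem inner_covOp_nonneg {Q : Measure 𝒵} [IsFiniteMeasure Q] {κ : ℝ}
    (hφ : AEStronglyMeasurable (featureMap H : 𝒵 → H) Q)
    (hκ : ∀ᵐ z ∂Q, ‖featureMap H z‖ ≤ κ) (x : H) :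
    0 ≤ inner ℝ (covOp H Q x) x := by
  rw [inner_covOp hφ hκ]
  exact integral_nonneg fun z => mul_self_nonneg _

theorem isSymmetric_covOp {Q : Measure 𝒵} [IsFiniteMeasure Q] {κ : ℝ}
    (hφ : AEStronglyMeasurable (featureMap H : 𝒵 → H) Q)
    (hκ : ∀ᵐ z ∂Q, ‖featureMap H z‖ ≤ κ) :
    (covOp H Q : H →ₗ[ℝ] H).IsSymmetric := by
  intro x y
  change inner ℝ (covOp H Q x) y = inner ℝ x (covOp H Q y)
  rw [real_inner_comm _ x, inner_covOp hφ hκ, inner_covOp hφ hκ]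
  simp_rw [mul_comm]

/-- If the density ratio of `Prior` and `Q` is represented by `r ∈ H`, then the embedding of
`Prior` is the image of `r` under the covariance operator of `Q`. -/
theorem meanEmbedding_eq_covOp_apply {Q Prior base : Measure 𝒵} [IsFiniteMeasure Q] {κ : ℝ}
    (hφ : AEStronglyMeasurable (featureMap H : 𝒵 → H) Q)
    (hκ : ∀ᵐ z ∂Q, ‖featureMap H z‖ ≤ κ) {p π : 𝒵 → ℝ} (hp : Measurable p) (hπ : Measurable π)
    (hp_nonneg : ∀ z, 0 ≤ p z) (hπ_nonneg : ∀ z, 0 ≤ π z)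
    (hQ : Q = base.withDensity fun z => ENNReal.ofReal (p z))
    (hPrior : Prior = base.withDensity fun z => ENNReal.ofReal (π z))
    {r : H} (hr : IsDensityRatio base p π r) :
    meanEmbedding H Prior = covOp H Q r := by
  rw [covOp_apply hφ hκ, meanEmbedding, hPrior, hQ,
    integral_withDensity_eq_integral_toReal_smul hπ.ennreal_ofReal (by simp),
    integral_withDensity_eq_integral_toReal_smul hp.ennreal_ofReal (by simp)]
  refine integral_congr_ae ?_
  filter_upwards [hr.eq_mul] with z hz
  rw [ENNReal.toReal_ofReal (hp_nonneg z), ENNReal.toReal_ofReal (hπ_nonneg z), hz, smul_smul,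
    mul_comm]

end FeatureMap

/-! ### Second moments and Chebyshev's inequality in `H` -/

section Probability

/-- The second moment of a sum of `n` centred, independent, bounded, identically distributed
vectors grows at most linearly in `n`. -/
theorem integral_norm_sum_sq_le {Ω 𝒵 H : Type*} [MeasurableSpace Ω] {Pr : Measure Ω}
    [IsProbabilityMeasure Pr] [MeasurableSpace 𝒵] {Q : Measure 𝒵}
    [NormedAddCommGroup H] [InnerProductSpace ℝ H] [CompleteSpace H]
    {Z : ℕ → Ω → 𝒵} (hZ : ∀ i, HasLaw (Z i) Q Pr)
    (hind : Pairwise fun i j => Z i ⟂ᵢ[Pr] Z j) {ξ : 𝒵 → H} (hξ : AEStronglyMeasurable ξ Q)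
    (hmean : ∫ z, ξ z ∂Q = 0) {K : ℝ} (hK : ∀ᵐ z ∂Q, ‖ξ z‖ ≤ K) (n : ℕ) :
    Integrable (fun ω => ‖∑ i ∈ Finset.range n, ξ (Z i ω)‖ ^ 2) Pr ∧
    ∫ ω, ‖∑ i ∈ Finset.range n, ξ (Z i ω)‖ ^ 2 ∂Pr ≤ n * K ^ 2 := by
  have hsm : ∀ i, AEStronglyMeasurable (fun ω => ξ (Z i ω)) Pr := fun i =>
    AEStronglyMeasurable.comp_aemeasurable (by rwa [(hZ i).map_eq]) (hZ i).aemeasurable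
  have hbd : ∀ i, ∀ᵐ ω ∂Pr, ‖ξ (Z i ω)‖ ≤ K := fun i =>
    ae_of_ae_map (hZ i).aemeasurable (by rwa [(hZ i).map_eq])
  have hprob : IsProbabilityMeasure Q := by
    rw [← (hZ 0).map_eq]; exact Measure.isProbabilityMeasure_map (hZ 0).aemeasurable
  have hξint : Integrable ξ Q := Integrable.of_bound hξ K hK
  have hint : ∀ i j, Integrable (fun ω => inner ℝ (ξ (Z i ω)) (ξ (Z j ω))) Pr := by
    intro i j
    refine Integrable.of_bound ((hsm i).inner (hsm j)) (K * K) ?_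
    filter_upwards [hbd i, hbd j] with ω h1 h2
    exact (norm_inner_le_norm _ _).trans
      (mul_le_mul h1 h2 (norm_nonneg _) ((norm_nonneg _).trans h1))
  -- Cross terms vanish by pairwise independence and centring, leaving only the `n` diagonal terms.
  have hoff : ∀ i j, i ≠ j → ∫ ω, inner ℝ (ξ (Z i ω)) (ξ (Z j ω)) ∂Pr = 0 := by
    intro i j hij
    have h := (hind hij).integral_bilin_comp_comp (f := ξ) (g := ξ) (hZ i).aemeasurable
      (hZ j).aemeasurable (by rwa [(hZ i).map_eq]) (by rwa [(hZ j).map_eq])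
      (innerSL ℝ : H →L[ℝ] H →L[ℝ] ℝ)
    have h0 : ∫ ω, ξ (Z i ω) ∂Pr = 0 := by
      rw [← hmean, ← (hZ i).integral_comp hξ]; rfl
    rw [h0, map_zero] at h
    exact h
  have hdiag : ∀ i, ∫ ω, inner ℝ (ξ (Z i ω)) (ξ (Z i ω)) ∂Pr ≤ K ^ 2 := by
    intro i
    have : ∫ ω, inner ℝ (ξ (Z i ω)) (ξ (Z i ω)) ∂Pr ≤ ∫ _, K ^ 2 ∂Pr := by
      refine integral_mono_ae (hint i i) (integrable_const _) ?_
      filter_upwards [hbd i] with ω h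
      rw [real_inner_self_eq_norm_sq]
      exact pow_le_pow_left₀ (norm_nonneg _) h 2
    simpa using this
  have hexp : ∀ ω, ‖∑ i ∈ Finset.range n, ξ (Z i ω)‖ ^ 2
      = ∑ i ∈ Finset.range n, ∑ j ∈ Finset.range n, inner ℝ (ξ (Z i ω)) (ξ (Z j ω)) := by
    intro ω
    rw [← real_inner_self_eq_norm_sq, sum_inner]
    simp_rw [inner_sum]
  simp_rw [hexp]
  refine ⟨integrable_finsetSum _ fun i _ => integrable_finsetSum _ fun j _ => hint i j, ?_⟩
  rw [integral_finsetSum _ fun i _ => integrable_finsetSum _ fun j _ => hint i j]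
  calc ∑ i ∈ Finset.range n, ∫ ω, ∑ j ∈ Finset.range n, inner ℝ (ξ (Z i ω)) (ξ (Z j ω)) ∂Pr
      ≤ ∑ i ∈ Finset.range n, K ^ 2 := by
        refine Finset.sum_le_sum fun i hi => ?_
        rw [integral_finsetSum _ fun j _ => hint i j, Finset.sum_eq_single i
          (fun j _ hji => hoff i j hji.symm) (fun h => absurd hi h)]
        exact hdiag i
    _ = n * K ^ 2 := by simp

/-- The empirical covariance operator concentrates around the covariance operator at rate
`n ^ (-1/2)`, pointwise on vectors of norm at most `R`. -/
theorem measure_lt_norm_empCovOp_sub_covOp_apply_le {Ω 𝒵 H : Type*} [MeasurableSpace Ω]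
    {Pr : Measure Ω} [IsProbabilityMeasure Pr] [MeasurableSpace 𝒵] {Q : Measure 𝒵}
    [NormedAddCommGroup H] [InnerProductSpace ℝ H] [CompleteSpace H] [RKHS ℝ H 𝒵 ℝ]
    {Z : ℕ → Ω → 𝒵} (hZ : ∀ i, HasLaw (Z i) Q Pr)
    (hind : Pairwise fun i j => Z i ⟂ᵢ[Pr] Z j)
    (hφ : AEStronglyMeasurable (featureMap H : 𝒵 → H) Q) {κ : ℝ}
    (hκ : ∀ᵐ z ∂Q, ‖featureMap H z‖ ≤ κ) {n : ℕ} (hn : 0 < n) {t R : ℝ} (ht : 0 < t) {x : H}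
    (hx : ‖x‖ ≤ R) :
    Pr {ω | t < ‖(empCovOp H (fun i => Z i ω) n - covOp H Q) x‖} ≤
      ENNReal.ofReal ((2 * κ ^ 2 * R) ^ 2 / (n * t ^ 2)) := by
  have hprob : IsProbabilityMeasure Q := by
    rw [← (hZ 0).map_eq]; exact Measure.isProbabilityMeasure_map (hZ 0).aemeasurable
  have hint := integrable_apply_smul_featureMap hφ hκ x
  have hsmul : ∀ᵐ z ∂Q, ‖x z • featureMap H z‖ ≤ κ ^ 2 * R := by
    filter_upwards [hκ] with z hz
    have h0 : 0 ≤ κ := (norm_nonneg _).trans hz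
    have h1 : 0 ≤ R := (norm_nonneg _).trans hx
    rw [norm_smul, Real.norm_eq_abs]
    calc |x z| * ‖featureMap H z‖ ≤ (‖featureMap H z‖ * ‖x‖) * ‖featureMap H z‖ := by
          gcongr; exact abs_apply_le x z
      _ ≤ (κ * R) * κ := by gcongr
      _ = κ ^ 2 * R := by ring
  have hC : ‖covOp H Q x‖ ≤ κ ^ 2 * R := by
    rw [covOp_apply hφ hκ]
    simpa using norm_integral_le_of_norm_le_const hsmul
  -- One `κ ^ 2 * R` for the vector and one for its mean.
  have hbd : ∀ᵐ z ∂Q, ‖x z • featureMap H z - covOp H Q x‖ ≤ 2 * κ ^ 2 * R := by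
    filter_upwards [hsmul] with z hz
    calc _ ≤ _ := norm_sub_le _ _
      _ ≤ 2 * κ ^ 2 * R := by linarith
  obtain ⟨hi, hle⟩ := integral_norm_sum_sq_le (n := n) hZ hind
    (ξ := fun z => x z • featureMap H z - covOp H Q x)
    (hint.1.sub aestronglyMeasurable_const)
    (by rw [integral_sub hint (integrable_const _), covOp_apply hφ hκ]; simp) hbd
  have hn' : (0 : ℝ) < n := by exact_mod_cast hn
  have heq : ∀ ω, ‖∑ i ∈ Finset.range n, (x (Z i ω) • featureMap H (Z i ω) - covOp H Q x)‖
      = n * ‖(empCovOp H (fun i => Z i ω) n - covOp H Q) x‖ := by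
    intro ω
    rw [sub_apply, empCovOp_apply, Finset.sum_sub_distrib, Finset.sum_const, Finset.card_range,
      ← Real.norm_of_nonneg hn'.le, ← norm_smul, Real.norm_of_nonneg hn'.le, smul_sub, smul_smul,
      mul_inv_cancel₀ hn'.ne', one_smul, Nat.cast_smul_eq_nsmul]
  -- Markov for the squared norm of the unnormalized sum, at level `(n t)²`; dividing by `n` once
  -- leaves `n t²` in the denominator.
  have hmarkov := mul_meas_ge_le_integral_of_nonneg
    (Eventually.of_forall fun ω => sq_nonneg _) hi ((n * t) ^ 2)
  have hreal : Pr.real {ω | t < ‖(empCovOp H (fun i => Z i ω) n - covOp H Q) x‖} ≤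
      (2 * κ ^ 2 * R) ^ 2 / (n * t ^ 2) := by
    rw [le_div_iff₀ (by positivity)]
    have hsub : Pr.real {ω | t < ‖(empCovOp H (fun i => Z i ω) n - covOp H Q) x‖} ≤
        Pr.real {ω | (n * t) ^ 2 ≤
          ‖∑ i ∈ Finset.range n, (x (Z i ω) • featureMap H (Z i ω) - covOp H Q x)‖ ^ 2} := by
      refine measureReal_mono fun ω hω => ?_
      simp only [Set.mem_ofPred_eq] at hω ⊢
      rw [heq]
      gcongr
    have h := (mul_le_mul_of_nonneg_left hsub (by positivity)).trans (hmarkov.trans hle)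
    refine le_of_mul_le_mul_left ?_ hn'
    linarith
  rw [← ofReal_measureReal]
  exact ENNReal.ofReal_le_ofReal hreal

end Probability

/-! ### Calculus of `O_p` -/

section StochasticOrder

variable {Ω : Type*} [MeasurableSpace Ω] {Pr : Measure Ω} {X Y : ℕ → Ω → ℝ≥0∞} {a b : ℕ → ℝ}

theorem IsBigOp.add (hX : IsBigOp Pr X a) (hY : IsBigOp Pr Y a) (ha : ∀ n, 0 ≤ a n) :
    IsBigOp Pr (fun n ω => X n ω + Y n ω) a := by
  intro ε hε
  obtain ⟨M, hM, h1⟩ := hX (ε / 2) (ENNReal.half_pos hε.ne')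
  obtain ⟨N, hN, h2⟩ := hY (ε / 2) (ENNReal.half_pos hε.ne')
  refine ⟨M + N, by positivity, ?_⟩
  filter_upwards [h1, h2] with n h1 h2
  calc Pr {ω | ENNReal.ofReal ((M + N) * a n) < X n ω + Y n ω}
      ≤ Pr ({ω | ENNReal.ofReal (M * a n) < X n ω} ∪ {ω | ENNReal.ofReal (N * a n) < Y n ω}) := by
        refine measure_mono fun ω hω => ?_
        by_contra hcon
        simp only [Set.mem_union, Set.mem_ofPred_eq, not_or, not_lt] at hcon hω
        refine hω.not_ge ?_
        rw [add_mul, ENNReal.ofReal_add (mul_nonneg hM.le (ha n)) (mul_nonneg hN.le (ha n))]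
        exact add_le_add hcon.1 hcon.2
    _ ≤ ε / 2 + ε / 2 := (measure_union_le _ _).trans (add_le_add h1 h2)
    _ = ε := ENNReal.add_halves ε

/-- Transfers a rate through a deterministic factor `c`. It serves for the amplification by `η⁻¹`,
for the feature bound, and, with `c = 1`, for plain domination. -/
theorem IsBigOp.of_le_mul (hY : IsBigOp Pr Y a) {c : ℕ → ℝ} {K : ℝ} (hK : 0 < K)
    (hc : ∀ᶠ n in atTop, 0 ≤ c n) (hrate : ∀ᶠ n in atTop, c n * a n ≤ K * b n)
    (hle : ∀ᶠ n in atTop, ∀ ω, X n ω ≤ ENNReal.ofReal (c n) * Y n ω) :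
    IsBigOp Pr X b := by
  intro ε hε
  obtain ⟨M, hM, h⟩ := hY ε hε
  refine ⟨M * K, by positivity, ?_⟩
  filter_upwards [h, hc, hrate, hle] with n h hc hrate hle
  refine (measure_mono fun ω hω => ?_).trans h
  by_contra hcon
  simp only [Set.mem_ofPred_eq, not_lt] at hcon hω
  refine hω.not_ge ?_
  calc X n ω ≤ ENNReal.ofReal (c n) * Y n ω := hle ω
    _ ≤ ENNReal.ofReal (c n) * ENNReal.ofReal (M * a n) := by gcongr
    _ = ENNReal.ofReal (c n * (M * a n)) := (ENNReal.ofReal_mul hc).symm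
    _ ≤ ENNReal.ofReal (M * K * b n) := by
        refine ENNReal.ofReal_le_ofReal ?_
        have := mul_le_mul_of_nonneg_left hrate hM.le
        linarith

theorem isBigOp_const {c : ℕ → ℝ} {K : ℝ} (hK : 0 < K)
    (hrate : ∀ᶠ n in atTop, c n ≤ K * b n) :
    IsBigOp Pr (fun n _ => ENNReal.ofReal (c n)) b := by
  intro ε _
  refine ⟨K, hK, ?_⟩
  filter_upwards [hrate] with n hn
  have h : {ω : Ω | ENNReal.ofReal (K * b n) < ENNReal.ofReal (c n)} = ∅ :=
    Set.eq_empty_of_forall_notMem fun ω (hω : _ < _) =>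
      hω.not_ge (ENNReal.ofReal_le_ofReal hn)
  rw [h, measure_empty]
  exact zero_le

end StochasticOrder

/-! ### Balancing bias and stochastic error -/

section Rates

variable {Ω 𝒵 H : Type*} [MeasurableSpace Ω] {Pr : Measure Ω} [IsProbabilityMeasure Pr]
  [MeasurableSpace 𝒵] {Q : Measure 𝒵}
  [NormedAddCommGroup H] [InnerProductSpace ℝ H] [CompleteSpace H] [RKHS ℝ H 𝒵 ℝ]

/-- The error of the empirical covariance operator on a bounded sequence of deterministic vectors
is of order `n ^ (-α)` for `α ≤ 1 / 2`. -/
theorem isBigOp_empCovOp_sub_covOp_apply {Z : ℕ → Ω → 𝒵} (hZ : ∀ i, HasLaw (Z i) Q Pr)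
    (hind : Pairwise fun i j => Z i ⟂ᵢ[Pr] Z j)
    (hφ : AEStronglyMeasurable (featureMap H : 𝒵 → H) Q) {κ : ℝ}
    (hκ : ∀ᵐ z ∂Q, ‖featureMap H z‖ ≤ κ) {R : ℝ} {v : ℕ → H}
    (hv : ∀ᶠ n in atTop, ‖v n‖ ≤ R) {α : ℝ} (hα : α ≤ 1 / 2) :
    IsBigOp Pr (fun n ω => ‖(empCovOp H (fun i => Z i ω) n - covOp H Q) (v n)‖ₑ)
      (fun n => (n : ℝ) ^ (-α)) := by
  intro ε hε
  obtain ⟨δ, hδ, hδε⟩ : ∃ δ : ℝ, 0 < δ ∧ ENNReal.ofReal δ ≤ ε := by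
    rcases eq_or_ne ε ∞ with rfl | htop
    · exact ⟨1, one_pos, le_top⟩
    · exact ⟨ε.toReal, ENNReal.toReal_pos hε.ne' htop, ENNReal.ofReal_toReal_le⟩
  set A := (2 * κ ^ 2 * R) ^ 2 with hA
  have hA0 : 0 ≤ A := sq_nonneg _
  -- Chebyshev requires `A ≤ δ M²`; the summand `1` gives `M² ≥ A / δ` without a square root and
  -- keeps `M` positive when `A = 0`.
  refine ⟨1 + A / δ, by positivity, ?_⟩
  filter_upwards [hv, eventually_ge_atTop 1] with n hvn hn
  have hn0 : (0 : ℝ) < n := by exact_mod_cast hn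
  have hn1 : (1 : ℝ) ≤ n := by exact_mod_cast hn
  have hpos : 0 < (1 + A / δ) * (n : ℝ) ^ (-α) := by positivity
  have hset : {ω | ENNReal.ofReal ((1 + A / δ) * (n : ℝ) ^ (-α))
        < ‖(empCovOp H (fun i => Z i ω) n - covOp H Q) (v n)‖ₑ}
      = {ω | (1 + A / δ) * (n : ℝ) ^ (-α)
        < ‖(empCovOp H (fun i => Z i ω) n - covOp H Q) (v n)‖} := by
    ext ω
    rw [Set.mem_ofPred_eq, Set.mem_ofPred_eq, ← ofReal_norm,
      ENNReal.ofReal_lt_ofReal_iff_of_nonneg hpos.le]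
  rw [hset]
  refine (measure_lt_norm_empCovOp_sub_covOp_apply_le hZ hind hφ hκ hn hpos hvn).trans
    ((ENNReal.ofReal_le_ofReal ?_).trans hδε)
  -- This is where `α ≤ 1 / 2` enters: sampling noise is no larger than `n ^ (-α)`.
  have hrate : 1 ≤ (n : ℝ) * ((n : ℝ) ^ (-α)) ^ 2 := by
    have h : (n : ℝ) * ((n : ℝ) ^ (-α)) ^ 2 = (n : ℝ) ^ (1 - 2 * α) := by
      rw [← Real.rpow_natCast, ← Real.rpow_mul hn0.le]
      nth_rewrite 1 [← Real.rpow_one (n : ℝ)]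
      rw [← Real.rpow_add hn0]
      congr 1
      push_cast
      ring
    rw [h]
    exact Real.one_le_rpow hn1 (by linarith)
  rw [div_le_iff₀ (by positivity)]
  have h1 : A ≤ δ * (1 + A / δ) ^ 2 := by
    have h2 : δ * (A / δ) = A := mul_div_cancel₀ A hδ.ne'
    have h3 : 0 ≤ A / δ := by positivity
    have h4 : δ * (A / δ) ≤ δ * (1 + A / δ) ^ 2 := by
      gcongr
      nlinarith
    linarith
  calc A ≤ δ * (1 + A / δ) ^ 2 * 1 := by linarith
    _ ≤ δ * (1 + A / δ) ^ 2 * ((n : ℝ) * ((n : ℝ) ^ (-α)) ^ 2) := by gcongr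
    _ = _ := by ring

/-- Convergence rate of the untruncated estimator in the norm of the RKHS. -/
theorem isBigOp_norm_sub_kulsifUntruncated {Z : ℕ → Ω → 𝒵} (hZ : ∀ i, HasLaw (Z i) Q Pr)
    (hind : Pairwise fun i j => Z i ⟂ᵢ[Pr] Z j)
    (hφ : AEStronglyMeasurable (featureMap H : 𝒵 → H) Q) {κ : ℝ}
    (hκ : ∀ᵐ z ∂Q, ‖featureMap H z‖ ≤ κ) {r g : H} {β α : ℝ} (hβ : 0 < β) (hβ' : β ≤ 1)
    (hα : α ≤ 1 / 2) (hsource : r = fracPow (covOp H Q) β g) {m : ℕ → Ω → H}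
    (hm : IsBigOp Pr (fun n ω => ‖m n ω - covOp H Q r‖ₑ) (fun n => (n : ℝ) ^ (-α)))
    {η : ℕ → ℝ} (hη_pos : ∀ᶠ n in atTop, 0 < η n)
    (hη : η =Θ[atTop] fun n : ℕ => (n : ℝ) ^ (-(α / (β + 1)))) :
    IsBigOp Pr (fun n ω => ‖r - kulsifUntruncated (fun i => Z i ω) n (η n) (m n ω)‖ₑ)
      (fun n => (n : ℝ) ^ (-(α * β / (β + 1)))) := by
  have hprob : IsProbabilityMeasure Q := by
    rw [← (hZ 0).map_eq]; exact Measure.isProbabilityMeasure_map (hZ 0).aemeasurable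
  have hCpos := inner_covOp_nonneg hφ hκ
  obtain ⟨c, hc, hupper⟩ := hη.1.exists_pos
  obtain ⟨c', hc', hlower⟩ := hη.2.exists_pos
  -- The lower bound on `η` controls `η⁻¹`, via `α = α/(β+1) + αβ/(β+1)`. The upper bound on `η` is
  -- what controls the bias.
  have hrate_var : ∀ᶠ n : ℕ in atTop, (η n)⁻¹ * (n : ℝ) ^ (-α) ≤
      c' * (n : ℝ) ^ (-(α * β / (β + 1))) := by
    filter_upwards [hlower.bound, hη_pos, eventually_gt_atTop 0] with n h hpos hn
    have hn0 : (0 : ℝ) < n := by exact_mod_cast hn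
    rw [Real.norm_of_nonneg (by positivity), Real.norm_of_nonneg hpos.le] at h
    rw [inv_mul_le_iff₀ hpos]
    have hsplit : (n : ℝ) ^ (-α)
        = (n : ℝ) ^ (-(α / (β + 1))) * (n : ℝ) ^ (-(α * β / (β + 1))) := by
      rw [← Real.rpow_add hn0]
      congr 1
      field_simp
      ring
    rw [hsplit]
    calc _ ≤ c' * η n * (n : ℝ) ^ (-(α * β / (β + 1))) := by gcongr
      _ = _ := by ring
  have hrate_bias : ∀ᶠ n : ℕ in atTop, η n ^ β * ‖g‖ ≤
      (c ^ β * (‖g‖ + 1)) * (n : ℝ) ^ (-(α * β / (β + 1))) := by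
    filter_upwards [hupper.bound, hη_pos, eventually_gt_atTop 0] with n h hpos hn
    have hn0 : (0 : ℝ) < n := by exact_mod_cast hn
    rw [Real.norm_of_nonneg hpos.le, Real.norm_of_nonneg (by positivity)] at h
    have hpow : η n ^ β ≤ c ^ β * (n : ℝ) ^ (-(α * β / (β + 1))) := by
      calc η n ^ β ≤ (c * (n : ℝ) ^ (-(α / (β + 1)))) ^ β := by gcongr
        _ = c ^ β * (n : ℝ) ^ (-(α * β / (β + 1))) := by
          rw [Real.mul_rpow hc.le (by positivity), ← Real.rpow_mul hn0.le]
          congr 2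
          ring
    calc η n ^ β * ‖g‖ ≤ (c ^ β * (n : ℝ) ^ (-(α * β / (β + 1)))) * (‖g‖ + 1) := by
          gcongr
          linarith
      _ = _ := by ring
  -- Coercivity gives `‖η (C + η)⁻¹ r‖ ≤ ‖r‖`, so the vectors on which `Ĉ - C` acts stay bounded as
  -- `η` tends to `0`.
  have hres : ∀ᶠ n in atTop,
      ‖r - η n • (covOp H Q + η n • ContinuousLinearMap.id ℝ H).inverse r‖ ≤ 2 * ‖r‖ := by
    filter_upwards [hη_pos] with n hpos
    have hinv := isInvertible_add_smul_id _ hCpos hpos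
    have hu := hinv.inverse_apply_eq.mp
      (rfl : (covOp H Q + η n • ContinuousLinearMap.id ℝ H).inverse r = _)
    have h := le_norm_add_smul_id (covOp H Q) hCpos (η := η n)
      ((covOp H Q + η n • ContinuousLinearMap.id ℝ H).inverse r)
    rw [← hu] at h
    refine (norm_sub_le _ _).trans ?_
    rw [norm_smul, Real.norm_of_nonneg hpos.le]
    linarith
  have hvar := isBigOp_empCovOp_sub_covOp_apply hZ hind hφ hκ hres hα
  have hrate_nonneg : ∀ n : ℕ, 0 ≤ (n : ℝ) ^ (-α) := fun n => by positivity
  have hnonneg : ∀ n : ℕ, 0 ≤ (n : ℝ) ^ (-(α * β / (β + 1))) := fun n => by positivity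
  have hstoch : IsBigOp Pr (fun n ω => ENNReal.ofReal (η n)⁻¹ * (‖m n ω - covOp H Q r‖ₑ +
      ‖(empCovOp H (fun i => Z i ω) n - covOp H Q)
        (r - η n • (covOp H Q + η n • ContinuousLinearMap.id ℝ H).inverse r)‖ₑ))
      (fun n => (n : ℝ) ^ (-(α * β / (β + 1)))) :=
    (hm.add hvar hrate_nonneg).of_le_mul hc' (hη_pos.mono fun n h => (inv_pos.mpr h).le)
      hrate_var (Eventually.of_forall fun n ω => le_rfl)
  have hbias : IsBigOp Pr (fun n _ => ENNReal.ofReal (η n ^ β * ‖g‖))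
      (fun n => (n : ℝ) ^ (-(α * β / (β + 1)))) :=
    isBigOp_const (by positivity) hrate_bias
  refine (hstoch.add hbias hnonneg).of_le_mul (c := fun _ => 1) one_pos
    (Eventually.of_forall fun _ => zero_le_one) (Eventually.of_forall fun _ => le_rfl) ?_
  filter_upwards [hη_pos] with n hpos ω
  have h := norm_inverse_apply_sub_le (covOp H Q) (empCovOp H (fun i => Z i ω) n) hCpos
    (inner_empCovOp_nonneg _ _) hpos r (m n ω)
  have hb : ‖η n • (covOp H Q + η n • ContinuousLinearMap.id ℝ H).inverse r‖ ≤
      η n ^ β * ‖g‖ := by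
    rw [hsource]
    exact norm_smul_inverse_fracPow_le _ (isSymmetric_covOp hφ hκ) hCpos hpos hβ hβ' g
  rw [ENNReal.ofReal_one, one_mul, ← ofReal_norm, ← ofReal_norm,
    ← ofReal_norm, ← ENNReal.ofReal_add (norm_nonneg _) (norm_nonneg _),
    ← ENNReal.ofReal_mul (inv_pos.mpr hpos).le,
    ← ENNReal.ofReal_add (by positivity) (by positivity)]
  refine ENNReal.ofReal_le_ofReal ?_
  rw [kulsifUntruncated]
  linarith

end Rates

end KuLSIF

theorem mainTheorem1
    {𝒳 𝒵 Ω H : Type*} [MeasurableSpace 𝒳]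
    [TopologicalSpace 𝒵] [MeasurableSpace 𝒵] [OpensMeasurableSpace 𝒵]
    [MeasurableSpace Ω] (Pr : Measure Ω) [IsProbabilityMeasure Pr]
    -- the RKHS on `𝒵`, with a continuous kernel
    [NormedAddCommGroup H] [InnerProductSpace ℝ H] [CompleteSpace H]
    [TopologicalSpace.SeparableSpace H] [RKHS ℝ H 𝒵 ℝ]
    (hk : Continuous fun q : 𝒵 × 𝒵 => KuLSIF.scalarKernel H q.1 q.2)
    -- the joint law `P` of `(X, Z)` and the prior `Prior`, with densities `p`, `π` on `𝒵`
    (P : Measure (𝒳 × 𝒵)) [IsProbabilityMeasure P]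
    (Prior : Measure 𝒵) [IsProbabilityMeasure Prior]
    (base : Measure 𝒵) (p π : 𝒵 → ℝ) (hp_meas : Measurable p) (hπ_meas : Measurable π)
    (hp_nonneg : ∀ z, 0 ≤ p z) (hπ_nonneg : ∀ z, 0 ≤ π z)
    (hP : P.snd = base.withDensity fun z => ENNReal.ofReal (p z))
    (hPrior : Prior = base.withDensity fun z => ENNReal.ofReal (π z))
    -- almost sure boundedness of the feature map
    (κ₁ : ℝ) (hκ : ∀ᵐ z ∂P.snd, ‖KuLSIF.featureMap H z‖ ≤ κ₁)
    -- the density ratio lies in `H` and satisfies the source condition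
    (r₀ : H) (hr₀ : KuLSIF.IsDensityRatio base p π r₀)
    (β₁ : ℝ) (hβ₁ : β₁ ∈ Set.Ioc (0 : ℝ) (1 / 2)) (ζ₁ : ℝ) (g₁ : H) (hg₁ : ‖g₁‖ ≤ ζ₁)
    (hsource : r₀ = KuLSIF.fracPow (KuLSIF.covOp H P.snd) β₁ g₁)
    -- i.i.d. data with law `P`
    (D : ℕ → Ω → 𝒳 × 𝒵) (hD_law : ∀ i, HasLaw (D i) P Pr) (hD_indep : iIndepFun D Pr)
    -- the estimated prior embedding, based on sample size `n`
    (m : ℕ → Ω → H) (α₁ : ℝ) (hα₁ : α₁ ∈ Set.Ioc (0 : ℝ) (1 / 2))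
    (hm : KuLSIF.IsBigOp Pr (fun n ω => ‖m n ω - KuLSIF.meanEmbedding H Prior‖ₑ)
      (fun n => (n : ℝ) ^ (-α₁)))
    -- the regularization parameter
    (η : ℕ → ℝ) (hη_pos : ∀ᶠ n in atTop, 0 < η n)
    (hη : η =Θ[atTop] fun n : ℕ => (n : ℝ) ^ (-(α₁ / (β₁ + 1)))) :
    -- rate in `L^∞` of the law of `Z`
    KuLSIF.IsBigOp Pr
      (fun n ω => eLpNorm
        (fun z => r₀ z - KuLSIF.kulsif (fun i => (D i ω).2) n (η n) (m n ω) z) ∞ P.snd)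
      (fun n => (n : ℝ) ^ (-(α₁ * β₁ / (β₁ + 1)))) ∧
    -- rate in supremum norm over the whole of `𝒵`, when the kernel is bounded on all of `𝒵`
    ((∀ z, ‖KuLSIF.featureMap H z‖ ≤ κ₁) →
      KuLSIF.IsBigOp Pr
        (fun n ω => KuLSIF.supNorm
          (fun z => r₀ z - KuLSIF.kulsif (fun i => (D i ω).2) n (η n) (m n ω) z))
        (fun n => (n : ℝ) ^ (-(α₁ * β₁ / (β₁ + 1))))) := by
  have hφ : AEStronglyMeasurable (KuLSIF.featureMap H : 𝒵 → H) P.snd :=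
    (KuLSIF.continuous_featureMap hk).aestronglyMeasurable
  have hZ : ∀ i, HasLaw (fun ω => (D i ω).2) P.snd Pr := fun i =>
    ⟨measurable_snd.comp_aemeasurable (hD_law i).aemeasurable, by
      rw [Measure.snd, ← (hD_law i).map_eq,
        AEMeasurable.map_map_of_aemeasurable measurable_snd.aemeasurable (hD_law i).aemeasurable]
      rfl⟩
  have hind : Pairwise fun i j => (fun ω => (D i ω).2) ⟂ᵢ[Pr] (fun ω => (D j ω).2) :=
    fun i j hij => (hD_indep.indepFun hij).comp measurable_snd measurable_snd
  rw [KuLSIF.meanEmbedding_eq_covOp_apply hφ hκ hp_meas hπ_meas hp_nonneg hπ_nonneg hP hPrior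
    hr₀] at hm
  have hmain := KuLSIF.isBigOp_norm_sub_kulsifUntruncated hZ hind hφ hκ hβ₁.1
    (hβ₁.2.trans (by norm_num)) hα₁.2 hsource hm hη_pos hη
  -- Stated pointwise, wherever the feature bound holds, so that it yields both the essential and
  -- the true supremum. The absolute value spares a sign condition on `κ₁`.
  have hpt : ∀ n ω z, ‖KuLSIF.featureMap H z‖ ≤ κ₁ →
      ‖r₀ z - KuLSIF.kulsif (fun i => (D i ω).2) n (η n) (m n ω) z‖ₑ ≤ ENNReal.ofReal |κ₁| *
        ‖r₀ - KuLSIF.kulsifUntruncated (fun i => (D i ω).2) n (η n) (m n ω)‖ₑ := by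
    intro n ω z hz
    rw [← ofReal_norm, ← ofReal_norm, ← ENNReal.ofReal_mul (abs_nonneg _)]
    refine ENNReal.ofReal_le_ofReal
      ((KuLSIF.abs_sub_kulsif_le r₀ hr₀.nonneg _ n (η n) (m n ω) z).trans ?_)
    gcongr
    exact hz.trans (le_abs_self _)
  have hrate : ∀ᶠ n : ℕ in atTop, |κ₁| * (n : ℝ) ^ (-(α₁ * β₁ / (β₁ + 1))) ≤
      (|κ₁| + 1) * (n : ℝ) ^ (-(α₁ * β₁ / (β₁ + 1))) :=
    Eventually.of_forall fun n => by gcongr; linarith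
  refine ⟨?_, fun hall => ?_⟩
  · refine hmain.of_le_mul (c := fun _ => |κ₁|) (by positivity)
      (Eventually.of_forall fun _ => abs_nonneg _) hrate (Eventually.of_forall fun n ω => ?_)
    rw [eLpNorm_exponent_top]
    refine eLpNormEssSup_le_of_ae_enorm_bound ?_
    filter_upwards [hκ] with z hz
    exact hpt n ω z hz
  · refine hmain.of_le_mul (c := fun _ => |κ₁|) (by positivity)
      (Eventually.of_forall fun _ => abs_nonneg _) hrate (Eventually.of_forall fun n ω => ?_)
    exact iSup_le fun z => hpt n ω z (hall z)
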